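/- Let $p\ge 1$ be an integer. For $c>0$ let $a=a(c)=(a_n)_{n\in\mathbb Z}$ be the sequence with $a_n=1-c$ if $n\equiv 0\pmod p$ and $a_n=1$ otherwise, let $b=0$, and let $J=J(a,b)$ be the self-adjoint operator on $\ell^2(\mathbb Z)$ given by $(Jy)_n=a_{n-1}y_{n-1}+b_ny_n+a_ny_{n+1}$. A gap of the spectrum $\sigma(J)\subset\mathbb R$ is a non-empty open interval $(\alpha,\beta)$ with $\alpha,\beta\in\sigma(J)$ and $(\alpha,\beta)\cap\sigma(J)=\emptyset$; let $G(c)=\sum_i|\gamma_i|$ be the sum of the lengths of all gaps $\gamma_i$ of $\sigma(J(a(c),0))$, and let $L(c)=4(a_1\cdots a_p)^{1/p}-4\min_n a_n$. Then, as $c\to 0+$, $$G(c)=\frac{4(p-1)}{p}\,c+o(c),\qquad L(c)=\frac{4(p-1)}{p}\,c+o(c).$$ Consequently the estimate $\sum_i|\gamma_i|\ge 4(a_1\cdots a_p)^{1/p}-4\min_n a_n$ for $p$-periodic Jacobi matrices is asymptotically sharp for small $c>0$, in the sense that $G(c)=L(c)+o(L(c))$ as $c\to0+$. Moreover, for every $c>0$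 the minimal period of $a$ is $p$. -/

import Mathlib

open Filter Asymptotics Topology
open scoped ENNReal

/-- The complex Hilbert space `ℓ²(ℤ)`. -/
abbrev EllTwo : Type := lp (fun _ : ℤ => ℂ) 2

/-- A real sequence indexed by `ℤ` is bounded. -/
def IsBoundedSeq (u : ℤ → ℝ) : Prop := ∃ C : ℝ, ∀ n : ℤ, |u n| ≤ C

theorem memlp_shift (y : EllTwo) (k : ℤ) : Memℓp (fun n : ℤ => (y : ℤ → ℂ) (n + k)) 2 := by
  have h := lp.memℓp y
  rw [memℓp_gen_iff (by norm_num)] at h ⊢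
  exact ((Equiv.addRight k).summable_iff (f := fun n : ℤ => ‖(y : ℤ → ℂ) n‖ ^ (2 : ℝ≥0∞).toReal)).2 h

theorem memlp_bounded_mul {u : ℤ → ℝ} (hu : IsBoundedSeq u) {f : ℤ → ℂ} (hf : Memℓp f 2) :
    Memℓp (fun n : ℤ => (u n : ℂ) * f n) 2 := by
  obtain ⟨C, hC⟩ := hu
  have hf' := hf.const_smul (C : ℂ)
  rw [memℓp_gen_iff (by norm_num)] at hf' ⊢
  refine hf'.of_nonneg_of_le (fun n => by positivity) (fun n => ?_)
  refine Real.rpow_le_rpow (norm_nonneg _) ?_ (by norm_num)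
  have h1 : |u n| ≤ |C| := (hC n).trans (le_abs_self C)
  simpa [norm_mul] using mul_le_mul_of_nonneg_right h1 (norm_nonneg (f n))

theorem IsBoundedSeq.shift {u : ℤ → ℝ} (hu : IsBoundedSeq u) (k : ℤ) :
    IsBoundedSeq (fun n => u (n + k)) := by
  obtain ⟨C, hC⟩ := hu
  exact ⟨C, fun n => hC _⟩

theorem memlp_jacobi {a b : ℤ → ℝ} (ha : IsBoundedSeq a) (hb : IsBoundedSeq b) (y : EllTwo) :
    Memℓp (fun n : ℤ => (a (n - 1) : ℂ) * y (n - 1) + (b n : ℂ) * y n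
      + (a n : ℂ) * y (n + 1)) 2 :=
  ((memlp_bounded_mul (ha.shift (-1)) (memlp_shift y (-1))).add
    (memlp_bounded_mul hb (lp.memℓp y))).add (memlp_bounded_mul ha (memlp_shift y 1))

/-- The Jacobi matrix `J(a, b)` as a linear map of `ℓ²(ℤ)`:
`(J y) n = a (n - 1) y (n - 1) + b n y n + a n y (n + 1)`. -/
def jacobiLinearMap (a b : ℤ → ℝ) (ha : IsBoundedSeq a) (hb : IsBoundedSeq b) :
    EllTwo →ₗ[ℂ] EllTwo where
  toFun y := ⟨fun n : ℤ => (a (n - 1) : ℂ) * y (n - 1) + (b n : ℂ) * y n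
      + (a n : ℂ) * y (n + 1), memlp_jacobi ha hb y⟩
  map_add' y z := by
    ext n
    simp only [lp.coeFn_add, Pi.add_apply]
    ring
  map_smul' r y := by
    ext n
    simp only [lp.coeFn_smul, Pi.smul_apply, smul_eq_mul, RingHom.id_apply]
    ring

theorem jacobiLinearMap_continuous (a b : ℤ → ℝ) (ha : IsBoundedSeq a) (hb : IsBoundedSeq b) :
    Continuous (jacobiLinearMap a b ha hb) := by
  have hev : ∀ n : ℤ, Continuous (fun y : EllTwo => (y : ℤ → ℂ) n) := fun n =>
    (continuous_apply n).comp (lp.uniformContinuous_coe (p := 2)).continuous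
  refine LinearMap.continuous_of_seq_closed_graph _ (fun u x z hx hz => ?_)
  ext n
  refine tendsto_nhds_unique (((hev n).tendsto z).comp hz) ?_
  exact (((((hev (n - 1)).tendsto x).comp hx).const_mul (a (n - 1) : ℂ)).add
    ((((hev n).tendsto x).comp hx).const_mul (b n : ℂ))).add
    ((((hev (n + 1)).tendsto x).comp hx).const_mul (a n : ℂ))

/-- The Jacobi matrix `J(a, b)` with bounded real coefficients, as a bounded operator on
`ℓ²(ℤ)`. -/
def jacobiOperator (a b : ℤ → ℝ) (ha : IsBoundedSeq a) (hb : IsBoundedSeq b) :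
    EllTwo →L[ℂ] EllTwo :=
  ⟨jacobiLinearMap a b ha hb, jacobiLinearMap_continuous a b ha hb⟩

theorem jacobiOperator_apply (a b : ℤ → ℝ) (ha : IsBoundedSeq a) (hb : IsBoundedSeq b)
    (y : EllTwo) (n : ℤ) :
    jacobiOperator a b ha hb y n
      = (a (n - 1) : ℂ) * y (n - 1) + (b n : ℂ) * y n + (a n : ℂ) * y (n + 1) := rfl

/-- The spectrum of `J(a, b)`, as a set of real numbers (the operator is self-adjoint, so that
its spectrum is real). -/
def jacobiSpectrum (a b : ℤ → ℝ) (ha : IsBoundedSeq a) (hb : IsBoundedSeq b) : Set ℝ :=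
  {x : ℝ | (x : ℂ) ∈ spectrum ℂ (jacobiOperator a b ha hb)}

/-- The open interval `(g.1, g.2)` is a (non-degenerate) gap of the closed set `S`: it is
non-empty, misses `S`, and both its ends belong to `S`. -/
def IsGap (S : Set ℝ) (g : ℝ × ℝ) : Prop :=
  g.1 < g.2 ∧ g.1 ∈ S ∧ g.2 ∈ S ∧ Disjoint (Set.Ioo g.1 g.2) S

/-- The sum of the lengths of all gaps of `S` (degenerate gaps would contribute `0`). The sum is
taken in `[0, ∞]`, and it is finite when `S` is bounded. -/
noncomputable def totalGapLength (S : Set ℝ) : ℝ :=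
  (∑' g : {g : ℝ × ℝ // IsGap S g}, ENNReal.ofReal (g.1.2 - g.1.1)).toReal

/-- The sequence with `a n = 1 - c` when `p` divides `n`, and `a n = 1` otherwise. -/
def perturbedSeq (p : ℕ) (c : ℝ) (n : ℤ) : ℝ := if (p : ℤ) ∣ n then 1 - c else 1

theorem isBoundedSeq_perturbedSeq (p : ℕ) (c : ℝ) : IsBoundedSeq (perturbedSeq p c) := by
  refine ⟨max |1 - c| 1, fun n => ?_⟩
  unfold perturbedSeq
  split_ifs
  · exact le_max_left _ _
  · simp

theorem isBoundedSeq_zero : IsBoundedSeq (fun _ => 0) := ⟨0, fun _ => by simp⟩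

/-- The total length of the gaps in the spectrum of `J(a, 0)`, where `a n = 1 - c` for
`n ≡ 0 (mod p)` and `a n = 1` otherwise. -/
noncomputable def gapSum (p : ℕ) (c : ℝ) : ℝ :=
  totalGapLength (jacobiSpectrum (perturbedSeq p c) (fun _ => 0)
    (isBoundedSeq_perturbedSeq p c) isBoundedSeq_zero)

/-- The quantity `4 (a 1 ⋯ a p) ^ (1 / p) - 4 min a` of a `p`-periodic sequence `a` of positive
numbers (the range of such a sequence is finite, so that the infimum is a minimum). -/
noncomputable def gapLowerBound (p : ℕ) (a : ℤ → ℝ) : ℝ :=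
  4 * (∏ n ∈ Finset.Icc 1 p, a (n : ℤ)) ^ (1 / (p : ℝ)) - 4 * ⨅ n : ℤ, a n

open Polynomial

/-! ### Chebyshev polynomials and the periodic recurrence over a commutative ring -/

/-! Put `s = 1 - c`. Inside a period all weights are 1, so solutions are combinations of Chebyshev
polynomials, and the transfer matrix over one period has determinant 1 and trace `D / s`, where `D =
S_p - s² S_{p-2}` is the discriminant. The spectrum is `{x : |D x| ≤ 2s}`. One inclusion is spectral
mapping, since `D(J)` is `s` times the sum of two shifts; the other truncates a bounded Bloch
solution (`abs_discrPoly_le_of_mem_spectrum`, `mem_jacobiSpectrum_of_abs_discrPoly_le`).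

At `x = 2 cos k` the difference `4s² - D²` factors into two sines of the phase `φ(k) = (p+1)k/2 -
arg(1 + s e^{ik})`, taken at `k` and at `π - k`. As `φ` is strictly increasing, the points `α_j`
with `φ(α_j) = πj/2` determine all band edges, and the gaps have length `2 cos α_{p-1-i} + 2 cos
α_{i+1}` for `0 ≤ i < p - 1` (`gapSum_eq`).

The half-angle identity turns the equation for `α_j` into `α_j = πj/p - (2/p) arctan(c/(2-c)
tan(α_j/2))`, hence `cos α_j = cos(πj/p) + (1 - cos(πj/p)) c/p + o(c)`. In each gap the two cosines
of the unperturbed edges cancel, leaving `4c/p + o(c)`, and there are `p - 1` gaps. The lower bound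
has the same linear term because `x^(1/p)` has derivative `1/p` at 1. -/

theorem chebyshevS_det (R : Type*) [CommRing R] (x : R) (n : ℤ) :
    (Chebyshev.S R (n - 1)).eval x ^ 2
      - (Chebyshev.S R n).eval x * (Chebyshev.S R (n - 2)).eval x = 1 := by
  have h1 := congrArg (eval x) (Chebyshev.S_sq_add_S_sq R (n - 1))
  have h2 := congrArg (eval x) (Chebyshev.S_eq R n)
  simp only [sub_add_cancel, eval_add, eval_sub, eval_mul, eval_pow, eval_X, eval_one] at h1 h2
  linear_combination h1 - (Chebyshev.S R n).eval x * h2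

theorem chebyshevS_eval_succ (R : Type*) [CommRing R] (x : R) (n : ℤ) :
    (Chebyshev.S R (n + 1)).eval x
      = x * (Chebyshev.S R n).eval x - (Chebyshev.S R (n - 1)).eval x := by
  simp [Chebyshev.S_add_one R n]

/-- The discriminant of the `p`-periodic Jacobi matrix with `a n = s` for `p ∣ n`, `a n = 1`
otherwise, and `b = 0`. -/
noncomputable def discrPoly (R : Type*) [CommRing R] (p : ℕ) (s : R) : R[X] :=
  Chebyshev.S R p - C (s ^ 2) * Chebyshev.S R (p - 2)

section Recurrence

variable {R M : Type*} [CommRing R] [AddCommGroup M] [Module R M]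
  {p : ℕ} {x s : R} {w : ℤ → R} {e : ℤ → M}

theorem not_dvd_mul_add {p : ℕ} {m : ℤ} {i : ℕ} (h0 : 0 < i) (hi : i < p) :
    ¬ (p : ℤ) ∣ p * m + i := by
  intro h
  have h2 := (Int.dvd_add_right (Dvd.intro m rfl)).1 h
  exact absurd (Nat.le_of_dvd h0 (Int.natCast_dvd_natCast.1 h2)) (by omega)

/-- The free recurrence started from `e (p * m + 1)` and `s • e (p * m)`. The second component keeps
the factor `w (p * m + i)` because it is `s` at `i = 0` and 1 afterwards; in this form the induction
never divides by `s`. -/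
theorem recurrence_in_period
    (hw : ∀ n, w n = if (p : ℤ) ∣ n then s else 1)
    (he : ∀ n, x • e n = w (n - 1) • e (n - 1) + w n • e (n + 1)) (m : ℤ) (i : ℕ) (hi : i < p) :
    e (p * m + i + 1) = (Chebyshev.S R i).eval x • e (p * m + 1)
        - (s * (Chebyshev.S R (i - 1)).eval x) • e (p * m) ∧
      w (p * m + i) • e (p * m + i) = (Chebyshev.S R (i - 1)).eval x • e (p * m + 1)
        - (s * (Chebyshev.S R (i - 2)).eval x) • e (p * m) := by
  induction i with
  | zero => simp [hw]
  | succ i ih =>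
    obtain ⟨h1, h2⟩ := ih (by omega)
    have h3 := he (p * m + i + 1)
    have hw1 : w (p * m + i + 1) = 1 := by
      rw [hw, if_neg]
      have := not_dvd_mul_add (m := m) (Nat.succ_pos i) hi
      push_cast at this
      rwa [add_assoc]
    have hs1 := chebyshevS_eval_succ R x i
    have hs2 := chebyshevS_eval_succ R x (i - 1)
    simp only [add_sub_cancel_right, sub_add_cancel, hw1, one_smul] at h3 hs2
    rw [sub_sub] at hs2
    norm_num at hs2
    rw [h2, h1] at h3
    push_cast
    rw [← add_assoc, hw1, one_smul, h1, add_sub_cancel_right]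
    constructor
    · rw [hs1, ← sub_eq_iff_eq_add'.2 h3, hs2]
      module
    · congr 5
      ring

theorem recurrence_next_period (hp : 1 ≤ p)
    (hw : ∀ n, w n = if (p : ℤ) ∣ n then s else 1)
    (he : ∀ n, x • e n = w (n - 1) • e (n - 1) + w n • e (n + 1)) (m : ℤ) :
    s • e (p * (m + 1) + 1) = (Chebyshev.S R p).eval x • e (p * m + 1)
        - (s * (Chebyshev.S R (p - 1)).eval x) • e (p * m) ∧
    e (p * (m + 1)) = (Chebyshev.S R (p - 1)).eval x • e (p * m + 1)
        - (s * (Chebyshev.S R (p - 2)).eval x) • e (p * m) := by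
  obtain ⟨i, rfl⟩ : ∃ i, p = i + 1 := ⟨p - 1, by omega⟩
  obtain ⟨h1, h2⟩ := recurrence_in_period hw he m i (by omega)
  have h3 := he (((i + 1 : ℕ) : ℤ) * m + i + 1)
  have hs1 := chebyshevS_eval_succ R x i
  have hs2 := chebyshevS_eval_succ R x (i - 1)
  simp only [add_sub_cancel_right, sub_add_cancel] at h3 hs2
  rw [sub_sub] at hs2
  norm_num at hs2
  rw [h2, h1] at h3
  have e1 : ((i + 1 : ℕ) : ℤ) * (m + 1) = ((i + 1 : ℕ) : ℤ) * m + i + 1 := by push_cast; ring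
  have e2 : ((i + 1 : ℕ) : ℤ) - 1 = i := by push_cast; ring
  have e3 : ((i + 1 : ℕ) : ℤ) - 2 = i - 1 := by push_cast; ring
  have hw1 : w (((i + 1 : ℕ) : ℤ) * m + i + 1) = s := by
    rw [hw, if_pos ⟨m + 1, e1.symm⟩]
  rw [hw1] at h3
  rw [e2, e3, e1]
  refine ⟨?_, h1⟩
  rw [← sub_eq_iff_eq_add'.2 h3, Nat.cast_add, Nat.cast_one, hs1, hs2]
  module

/-- A solution of the periodic recurrence, translated by `p` to both sides. -/
theorem discrPoly_smul (hp : 1 ≤ p) (hs : IsUnit s)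
    (hw : ∀ n, w n = if (p : ℤ) ∣ n then s else 1)
    (he : ∀ n, x • e n = w (n - 1) • e (n - 1) + w n • e (n + 1)) (n : ℤ) :
    (discrPoly R p s).eval x • e n = s • e (n + p) + s • e (n - p) := by
  have hdet := chebyshevS_det R x p
  -- Cayley–Hamilton for the transfer matrix `T` of one period: with determinant 1 (`hdet`) and
  -- trace `D / s`, it reads `T + T⁻¹ = D / s`.
  have key : ∀ m : ℤ,
      (discrPoly R p s).eval x • e (p * m + 1)
        = s • e (p * (m + 1) + 1) + s • e (p * (m - 1) + 1) ∧
      (discrPoly R p s).eval x • e (p * m) = s • e (p * (m + 1)) + s • e (p * (m - 1)) := by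
    intro m
    obtain ⟨h1, h2⟩ := recurrence_next_period hp hw he (m - 1)
    obtain ⟨h3, h4⟩ := recurrence_next_period hp hw he m
    rw [sub_add_cancel] at h1 h2
    simp only [discrPoly, eval_sub, eval_mul, eval_C]
    generalize (Chebyshev.S R p).eval x = A at *
    generalize (Chebyshev.S R (p - 1)).eval x = B at *
    generalize (Chebyshev.S R (p - 2)).eval x = D at *
    have hd (v : M) : (B ^ 2 - A * D) • v = v := by rw [hdet, one_smul]
    constructor
    · rw [← hs.smul_left_cancel]
      linear_combination (norm := module) (-s) • h3 + (s ^ 2 * B) • h2 - (s ^ 2 * D) • h1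
        + (s ^ 2) • hd (e (p * (m - 1) + 1))
    · linear_combination (norm := module) (-s) • h4 + A • h2 - B • h1 + s • hd (e (p * (m - 1)))
  obtain ⟨m, i, hi, rfl⟩ : ∃ m : ℤ, ∃ i : ℕ, i < p ∧ n = p * m + i + 1 := by
    have hp' : (0 : ℤ) < p := by omega
    refine ⟨(n - 1) / p, ((n - 1) % p).toNat, ?_, ?_⟩
    · have := Int.emod_lt_of_pos (n - 1) hp'
      have := Int.emod_nonneg (n - 1) hp'.ne'
      omega
    · rw [Int.toNat_of_nonneg (Int.emod_nonneg _ hp'.ne'), Int.mul_ediv_add_emod, sub_add_cancel]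
  have g1 : (p : ℤ) * m + i + 1 + p = p * (m + 1) + i + 1 := by ring
  have g2 : (p : ℤ) * m + i + 1 - p = p * (m - 1) + i + 1 := by ring
  -- The coefficients here do not depend on `m`, so the identity passes from the two initial sites
  -- to the whole period.
  have h (m : ℤ) := (recurrence_in_period hw he m i hi).1
  rw [g1, g2, h, h, h]
  obtain ⟨k1, k2⟩ := key m
  linear_combination (norm := module) (Chebyshev.S R i).eval x • k1
    - (s * (Chebyshev.S R (i - 1)).eval x) • k2

end Recurrence

/-! ### The discriminant of the Jacobi operator -/

theorem eval_discrPoly_X (p : ℕ) (s : ℂ) :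
    (discrPoly ℂ[X] p (C s)).eval X = discrPoly ℂ p s := by
  have h (n : ℤ) : (Chebyshev.S ℂ[X] n).eval X = Chebyshev.S ℂ n := by
    rw [← Chebyshev.aeval_S (R := ℂ), aeval_X_left, AlgHom.id_apply]
  simp only [discrPoly, eval_sub, eval_mul, eval_C, h, map_pow, eval_pow]

/-- Transposition reverses products, which is harmless for polynomials in a single operator. -/
theorem aeval_dualMap {V : Type*} [AddCommGroup V] [Module ℂ V] (J : V →ₗ[ℂ] V) (q : ℂ[X])
    (f : Module.Dual ℂ V) :
    aeval (R := ℂ) (A := Module.End ℂ (Module.Dual ℂ V)) J.dualMap q f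
      = f ∘ₗ (aeval (R := ℂ) (A := Module.End ℂ V) J q) := by
  induction q using Polynomial.induction_on generalizing f with
  | C a => ext; simp [Module.algebraMap_end_apply]
  | add p q hp hq => ext; simp [hp, hq]
  | monomial n a h =>
    have h1 : C a * X ^ (n + 1) = (C a * X ^ n) * X := by ring
    have h2 : aeval (R := ℂ) (A := Module.End ℂ V) J (C a * X ^ (n + 1))
        = J * aeval (R := ℂ) (A := Module.End ℂ V) J (C a * X ^ n) := by
      rw [h1, mul_comm, map_mul, aeval_X]
    rw [h2, h1, map_mul, aeval_X, Module.End.mul_apply, h]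
    rfl

theorem aeval_toLinearMap (J : EllTwo →L[ℂ] EllTwo) (q : ℂ[X]) (y : EllTwo) :
    aeval (R := ℂ) (A := Module.End ℂ EllTwo) (J : EllTwo →ₗ[ℂ] EllTwo) q y = aeval J q y := by
  let F : (EllTwo →L[ℂ] EllTwo) →ₐ[ℂ] Module.End ℂ EllTwo :=
    { ContinuousLinearMap.toLinearMapRingHom with commutes' := fun _ => rfl }
  have := aeval_algHom_apply F J q
  exact congrArg (fun T : Module.End ℂ EllTwo => T y) this

/-- Let `X` act on the dual space by the transpose of `J`. The coordinate functionals then solve the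
Jacobi recurrence with spectral parameter `X`, so `discrPoly_smul` over the ring `ℂ[X]` becomes an
identity for the operator `D(J)`. -/
theorem aeval_discrPoly_jacobiOperator {p : ℕ} (hp : 1 ≤ p) {s : ℝ} (hs : s ≠ 0) {a b : ℤ → ℝ}
    (ha : IsBoundedSeq a) (hb : IsBoundedSeq b) (has : ∀ n, a n = if (p : ℤ) ∣ n then s else 1)
    (hb0 : ∀ n, b n = 0) (y : EllTwo) (n : ℤ) :
    aeval (jacobiOperator a b ha hb) (discrPoly ℂ p (s : ℂ)) y n
      = (s : ℂ) * y (n + p) + (s : ℂ) * y (n - p) := by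
  set J := jacobiOperator a b ha hb with hJ
  let φ : Module.End ℂ (Module.Dual ℂ EllTwo) := (J : EllTwo →ₗ[ℂ] EllTwo).dualMap
  let ev (k : ℤ) : Module.Dual ℂ EllTwo :=
    { toFun := fun y => y k, map_add' := fun _ _ => rfl, map_smul' := fun _ _ => rfl }
  let e (k : ℤ) : Module.AEval' φ := Module.AEval'.of φ (ev k)
  have hsu : IsUnit (C (s : ℂ) : ℂ[X]) :=
    isUnit_C.2 (isUnit_iff_ne_zero.2 (Complex.ofReal_ne_zero.2 hs))
  have h1 : ∀ n, (X : ℂ[X]) • e n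
      = (C (a (n - 1) : ℂ) : ℂ[X]) • e (n - 1) + (C (a n : ℂ) : ℂ[X]) • e (n + 1) := by
    intro k
    rw [Module.AEval'.X_smul_of]
    simp only [e, Module.AEval.C_smul, ← map_smul, ← map_add]
    congr 1
    ext y
    change jacobiOperator a b ha hb y k
      = (a (k - 1) : ℂ) * y (k - 1) + (a k : ℂ) * y (k + 1)
    simp [jacobiOperator_apply, hb0]
  have h2 := discrPoly_smul (x := (X : ℂ[X])) (s := C (s : ℂ)) (w := fun n => C (a n : ℂ)) (e := e)
    hp hsu (fun n => by simp only [has]; split_ifs <;> simp) h1 n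
  rw [eval_discrPoly_X] at h2
  simp only [e, Module.AEval.C_smul, ← map_smul, ← map_add] at h2
  rw [← Module.AEval.of_aeval_smul] at h2
  have h3 := congrArg (fun f : Module.Dual ℂ EllTwo => f y) ((Module.AEval'.of φ).injective h2)
  simp only [Module.End.smul_def, φ, aeval_dualMap] at h3
  rw [LinearMap.comp_apply, aeval_toLinearMap] at h3
  exact h3

theorem norm_ellTwo_shift (y : EllTwo) (k : ℤ) :
    ‖(⟨fun n => y (n + k), memlp_shift y k⟩ : EllTwo)‖ = ‖y‖ := by
  have h2 : (0 : ℝ) < (2 : ℝ≥0∞).toReal := by norm_num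
  rw [lp.norm_eq_tsum_rpow h2, lp.norm_eq_tsum_rpow h2]
  congr 1
  exact (Equiv.addRight k).tsum_eq (fun n => ‖y n‖ ^ (2 : ℝ≥0∞).toReal)

theorem complex_ofReal_eval_discrPoly (p : ℕ) (s x : ℝ) :
    (((discrPoly ℝ p s).eval x : ℝ) : ℂ) = (discrPoly ℂ p (s : ℂ)).eval (x : ℂ) := by
  simp [discrPoly]

/-- By spectral mapping `D x` lies in the spectrum of `D(J)`, whose norm is at most `2s` because
shifts are isometries. -/
theorem abs_discrPoly_le_of_mem_spectrum {p : ℕ} (hp : 1 ≤ p) {s : ℝ} (hs : 0 < s) {a b : ℤ → ℝ}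
    (ha : IsBoundedSeq a) (hb : IsBoundedSeq b) (has : ∀ n, a n = if (p : ℤ) ∣ n then s else 1)
    (hb0 : ∀ n, b n = 0) {x : ℝ} (hx : x ∈ jacobiSpectrum a b ha hb) :
    |(discrPoly ℝ p s).eval x| ≤ 2 * s := by
  have h1 := spectrum.subset_polynomial_aeval (𝕜 := ℂ) (jacobiOperator a b ha hb)
    (discrPoly ℂ p (s : ℂ)) ⟨(x : ℂ), hx, rfl⟩
  have hnt : Nontrivial EllTwo :=
    ⟨lp.single 2 0 (1 : ℂ), 0, fun h => by simpa using congrArg (fun y : EllTwo => y 0) h⟩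
  have h2 := spectrum.norm_le_norm_of_mem h1
  simp only [← complex_ofReal_eval_discrPoly, Complex.norm_real, Real.norm_eq_abs] at h2
  refine h2.trans (ContinuousLinearMap.opNorm_le_bound _ (by positivity) fun y => ?_)
  have h3 : aeval (jacobiOperator a b ha hb) (discrPoly ℂ p (s : ℂ)) y
      = (s : ℂ) • (⟨fun n => y (n + p), memlp_shift y p⟩ : EllTwo)
        + (s : ℂ) • (⟨fun n => y (n + -p), memlp_shift y (-p)⟩ : EllTwo) := by
    ext n
    rw [aeval_discrPoly_jacobiOperator hp hs.ne' ha hb has hb0]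
    rfl
  rw [h3]
  refine (norm_add_le _ _).trans (le_of_eq ?_)
  rw [norm_smul, norm_smul, norm_ellTwo_shift, norm_ellTwo_shift, Complex.norm_real,
    Real.norm_of_nonneg hs.le]
  ring

/-! ### Bounded generalized eigenfunctions and Bloch solutions -/

theorem jacobiOperator_single {a b : ℤ → ℝ} (ha : IsBoundedSeq a) (hb : IsBoundedSeq b)
    (n : ℤ) (z : ℂ) :
    jacobiOperator a b ha hb (lp.single 2 n z)
      = lp.single 2 (n - 1) (a (n - 1) * z) + lp.single 2 n (b n * z)
        + lp.single 2 (n + 1) (a n * z) := by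
  ext m
  rw [jacobiOperator_apply]
  simp only [lp.coeFn_add, Pi.add_apply, lp.coeFn_single, Pi.single_apply]
  have h1 : m - 1 = n ↔ m = n + 1 := by omega
  have h2 : m + 1 = n ↔ m = n - 1 := by omega
  simp only [h1, h2]
  rcases eq_or_ne m (n + 1) with rfl | h3
  · simp [show n + 1 ≠ n - 1 by omega]
  rcases eq_or_ne m (n - 1) with rfl | h4
  · simp [show n - 1 ≠ n + 1 by omega]
  rcases eq_or_ne m n with rfl | h5 <;> simp [*]

/-- Applied to truncations of `u`, the operator `x - J` leaves only boundary terms, which stay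
bounded while the norms of the truncations diverge. This rules out a bounded left inverse. -/
theorem mem_jacobiSpectrum_of_bounded_solution {a b : ℤ → ℝ} (ha : IsBoundedSeq a)
    (hb : IsBoundedSeq b) {x : ℝ} {u : ℤ → ℂ}
    (hu : ∀ n, (a (n - 1) : ℂ) * u (n - 1) + b n * u n + a n * u (n + 1) = x * u n)
    (hbd : ∃ K, ∀ n, ‖u n‖ ≤ K)
    (hdiv : ¬ Summable fun n : ℕ => ‖u n‖ ^ 2) : x ∈ jacobiSpectrum a b ha hb := by
  obtain ⟨K, hK⟩ := hbd
  have ⟨A, hA⟩ := ha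
  have hA0 : 0 ≤ A := (abs_nonneg _).trans (hA 0)
  have hK0 : 0 ≤ K := (norm_nonneg _).trans (hK 0)
  by_contra hx
  set T := algebraMap ℂ (EllTwo →L[ℂ] EllTwo) (x : ℂ) - jacobiOperator a b ha hb with hT
  have hTu : IsUnit T := spectrum.notMem_iff.1 hx
  obtain ⟨B, hB⟩ := hTu.exists_left_inv
  let y (N : ℕ) : EllTwo := ∑ n ∈ Finset.range N, lp.single 2 (n : ℤ) (u n)
  -- The defect created by cutting the solution between sites `n - 1` and `n`; `x - J` applied to a
  -- single site is a difference of two such defects, so the sum telescopes.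
  let w (n : ℤ) : EllTwo :=
    lp.single 2 (n - 1) (a (n - 1) * u n) - lp.single 2 n (a (n - 1) * u (n - 1))
  have hw (n : ℤ) : ‖w n‖ ≤ A * K + A * K := by
    have h (m : ℤ) (j : ℤ) : ‖lp.single (E := fun _ : ℤ => ℂ) 2 j ((a (n - 1) : ℂ) * u m)‖
        ≤ A * K := by
      rw [lp.norm_single (by norm_num), norm_mul, Complex.norm_real]
      exact mul_le_mul (hA _) (hK _) (norm_nonneg _) hA0
    exact (norm_sub_le _ _).trans (add_le_add (h _ _) (h _ _))
  have hTs (n : ℤ) : T (lp.single 2 n (u n)) = w (n + 1) - w n := by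
    have h1 : T (lp.single 2 n (u n)) = lp.single 2 n ((x : ℂ) * u n)
        - jacobiOperator a b ha hb (lp.single 2 n (u n)) := by
      rw [hT, ← smul_eq_mul, lp.single_smul]
      rfl
    rw [h1, jacobiOperator_single, ← hu]
    simp only [w, add_sub_cancel_right, lp.single_add]
    abel
  have hTy (N : ℕ) : T (y N) = w N - w 0 := by
    simp only [y, map_sum, hTs]
    exact_mod_cast Finset.sum_range_sub (fun n : ℕ => w n) N
  have hy (N : ℕ) : ‖y N‖ ≤ ‖B‖ * (4 * (A * K)) := by
    have h1 : B (T (y N)) = y N := congrArg (fun S : EllTwo →L[ℂ] EllTwo => S (y N)) hB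
    rw [← h1, hTy]
    refine (B.le_opNorm _).trans (mul_le_mul_of_nonneg_left ?_ (norm_nonneg _))
    linarith [norm_sub_le (w N) (w 0), hw N, hw 0]
  have hy2 (N : ℕ) : ∑ n ∈ Finset.range N, ‖u n‖ ^ 2 ≤ (‖B‖ * (4 * (A * K))) ^ 2 := by
    have h2 : (0 : ℝ) < (2 : ℝ≥0∞).toReal := by norm_num
    have h1 := lp.norm_sum_single (E := fun _ : ℤ => ℂ) h2 u
      ((Finset.range N).map Nat.castEmbedding)
    simp only [Finset.sum_map, Nat.castEmbedding_apply, ENNReal.toReal_ofNat,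
      Real.rpow_ofNat] at h1
    rw [← h1]
    exact pow_le_pow_left₀ (norm_nonneg _) (hy N) 2
  exact hdiv (summable_of_sum_range_le (fun _ => by positivity) hy2)

section Bloch

variable {p : ℕ} {s : ℝ} {a : ℤ → ℝ} {μ x : ℂ} {g : ℤ → ℂ}

/-- The continuation of the values `g 0, …, g (p - 1)` to a function on `ℤ` with
Floquet multiplier `μ`. -/
noncomputable def blochFun (p : ℕ) (μ : ℂ) (g : ℤ → ℂ) (n : ℤ) : ℂ :=
  μ ^ ((n - 1) / (p : ℤ)) * g ((n - 1) % p)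

theorem blochFun_apply (hp : 1 ≤ p) (m i : ℤ) (h0 : 0 ≤ i) (hi : i < p) :
    blochFun p μ g (p * m + i + 1) = μ ^ m * g i := by
  have hp' : (p : ℤ) ≠ 0 := by omega
  rw [blochFun, add_sub_cancel_right, Int.mul_add_emod_self_left, Int.emod_eq_of_lt h0 hi,
    Int.mul_add_ediv_left _ _ hp', Int.ediv_eq_zero_of_lt h0 hi, add_zero]

/-- A block consists of the sites `p * m + 1, …, p * m + p`, so the weight `s` sits on the bond
joining consecutive blocks. The hypotheses `hg0` and `hg1` are the matching conditions across that
bond. -/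
theorem blochFun_recurrence (hp : 1 ≤ p) (has : ∀ n, a n = if (p : ℤ) ∣ n then s else 1)
    (hμ : μ ≠ 0) (hg : ∀ i, g (i + 1) + g (i - 1) = x * g i) (hg0 : g p = s * μ * g 0)
    (hg1 : μ * g (-1) = s * g (p - 1)) (n : ℤ) :
    (a (n - 1) : ℂ) * blochFun p μ g (n - 1) + a n * blochFun p μ g (n + 1)
      = x * blochFun p μ g n := by
  have hp' : (0 : ℤ) < p := by omega
  obtain ⟨m, i, h0, hi, rfl⟩ : ∃ m i : ℤ, 0 ≤ i ∧ i < p ∧ n = p * m + i + 1 :=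
    ⟨(n - 1) / p, (n - 1) % p, Int.emod_nonneg _ hp'.ne', Int.emod_lt_of_pos _ hp', by
      rw [Int.mul_ediv_add_emod, sub_add_cancel]⟩
  have hleft : (a (p * m + i + 1 - 1) : ℂ) * blochFun p μ g (p * m + i + 1 - 1)
      = μ ^ m * g (i - 1) := by
    rw [add_sub_cancel_right, has]
    rcases h0.eq_or_lt with rfl | h0'
    · rw [if_pos (by simp), show (p : ℤ) * m + 0 = p * (m - 1) + (p - 1) + 1 by ring,
        blochFun_apply hp _ _ (by omega) (by omega), zero_sub, mul_left_comm, ← hg1,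
        ← mul_assoc, ← zpow_add_one₀ hμ, sub_add_cancel]
    · rw [if_neg, show (p : ℤ) * m + i = p * m + (i - 1) + 1 by ring,
        blochFun_apply hp _ _ (by omega) (by omega), Complex.ofReal_one, one_mul]
      lift i to ℕ using h0
      exact not_dvd_mul_add (by omega) (by omega)
  have hright : (a (p * m + i + 1) : ℂ) * blochFun p μ g (p * m + i + 1 + 1)
      = μ ^ m * g (i + 1) := by
    rw [has]
    rcases (show i + 1 ≤ p by omega).eq_or_lt with h1 | h1
    · rw [if_pos ⟨m + 1, by rw [← h1]; ring⟩,
        show (p : ℤ) * m + i + 1 + 1 = p * (m + 1) + 0 + 1 by rw [add_assoc _ i, h1]; ring,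
        blochFun_apply hp _ _ le_rfl hp', h1, hg0, zpow_add_one₀ hμ]
      ring
    · rw [if_neg, show (p : ℤ) * m + i + 1 + 1 = p * m + (i + 1) + 1 by ring,
        blochFun_apply hp _ _ (by omega) h1, Complex.ofReal_one, one_mul]
      lift i to ℕ using h0
      have := not_dvd_mul_add (m := m) (Nat.succ_pos i) (by omega : i + 1 < p)
      rwa [Nat.cast_succ, ← add_assoc] at this
  rw [hleft, hright, blochFun_apply hp _ _ h0 hi, ← mul_add, add_comm (g _), hg]
  ring

end Bloch

theorem mem_jacobiSpectrum_of_abs_discrPoly_le {p : ℕ} (hp : 1 ≤ p) {s : ℝ} (hs : 0 < s)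
    {a b : ℤ → ℝ} (ha : IsBoundedSeq a) (hb : IsBoundedSeq b)
    (has : ∀ n, a n = if (p : ℤ) ∣ n then s else 1) (hb0 : ∀ n, b n = 0) {x : ℝ}
    (hx : |(discrPoly ℝ p s).eval x| ≤ 2 * s) : x ∈ jacobiSpectrum a b ha hb := by
  obtain ⟨θ, hθ⟩ : ∃ θ : ℝ, (discrPoly ℝ p s).eval x = 2 * s * Real.cos θ := by
    rw [abs_le] at hx
    refine ⟨Real.arccos ((discrPoly ℝ p s).eval x / (2 * s)), ?_⟩
    rw [Real.cos_arccos]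
    · field_simp
    · rw [le_div_iff₀ (by positivity)]; linarith
    · rw [div_le_iff₀ (by positivity)]; linarith
  let μ : ℂ := Complex.exp (θ * Complex.I)
  have hμ0 : μ ≠ 0 := Complex.exp_ne_zero _
  have hμ1 : ‖μ‖ = 1 := Complex.norm_exp_ofReal_mul_I θ
  -- The characteristic equation of the transfer matrix, so `μ` is a Floquet multiplier.
  have hμ : (s : ℂ) * (μ ^ 2 + 1) = μ * (discrPoly ℂ p (s : ℂ)).eval (x : ℂ) := by
    rw [← complex_ofReal_eval_discrPoly, hθ]
    have h1 := Complex.two_cos (θ : ℂ)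
    have h2 : μ * Complex.exp (-θ * Complex.I) = 1 := by
      rw [← Complex.exp_add, neg_mul, add_neg_cancel, Complex.exp_zero]
    push_cast
    linear_combination (-(s : ℂ)) * h2 - s * μ * h1
  let S (n : ℤ) : ℂ := (Chebyshev.S ℂ n).eval (x : ℂ)
  have hSdet : S (p - 1) ^ 2 - S p * S (p - 2) = 1 := chebyshevS_det ℂ (x : ℂ) p
  have hD : (discrPoly ℂ p (s : ℂ)).eval (x : ℂ) = S p - s ^ 2 * S (p - 2) := by
    simp [discrPoly, S]
  -- Here `v 0` and `v 1` are the values of the solution at sites 1 and 0; the rows say that site `p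
  -- + 1` (times `s`) and site `p` carry `μ` times these values.
  obtain ⟨v, hv0, hv⟩ := Matrix.exists_mulVec_eq_zero_iff.2
    (show (!![S p - s * μ, -s * S (p - 1); S (p - 1), -s * S (p - 2) - μ]).det = 0 by
      rw [Matrix.det_fin_two_of]
      rw [hD] at hμ
      linear_combination hμ + s * hSdet)
  have hv1 := congrFun hv 0
  have hv2 := congrFun hv 1
  simp [Matrix.mulVec, dotProduct, Fin.sum_univ_two] at hv1 hv2
  let g (i : ℤ) : ℂ := S i * v 0 - s * S (i - 1) * v 1
  have hS0 : S 0 = 1 := by simp [S]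
  have hS1 : S (-1) = 0 := by simp [S]
  have hS2 : S (-2) = -1 := by simp [S]
  have hg (i : ℤ) : g (i + 1) + g (i - 1) = x * g i := by
    have h1 : S (i + 1) = _ := chebyshevS_eval_succ ℂ (x : ℂ) i
    have h2 : S (i - 1 + 1) = _ := chebyshevS_eval_succ ℂ (x : ℂ) (i - 1)
    change S (i + 1) = x * S i - S (i - 1) at h1
    change S (i - 1 + 1) = x * S (i - 1) - S (i - 1 - 1) at h2
    rw [sub_add_cancel] at h2
    simp only [g, add_sub_cancel_right]
    linear_combination v 0 * h1 - s * v 1 * h2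
  have hg0 : g p = s * μ * g 0 := by
    simp only [g, zero_sub, hS0, hS1]
    linear_combination hv1
  have hg1 : μ * g (-1) = s * g (p - 1) := by
    simp only [g, hS1, show (-1 : ℤ) - 1 = -2 by norm_num, hS2,
      show (p : ℤ) - 1 - 1 = p - 2 by ring]
    linear_combination -(s : ℂ) * hv2
  have hp' : (0 : ℤ) < p := by omega
  refine mem_jacobiSpectrum_of_bounded_solution ha hb (u := blochFun p μ g) (fun n => ?_) ?_ ?_
  · rw [hb0, Complex.ofReal_zero, zero_mul, add_zero]
    exact blochFun_recurrence hp has hμ0 hg hg0 hg1 n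
  · refine ⟨∑ i ∈ Finset.range p, ‖g i‖, fun n => ?_⟩
    rw [blochFun, norm_mul, norm_zpow, hμ1, one_zpow, one_mul]
    have h1 := Int.emod_nonneg (n - 1) hp'.ne'
    have h2 := Int.emod_lt_of_pos (n - 1) hp'
    lift (n - 1) % (p : ℤ) to ℕ using h1 with i
    exact Finset.single_le_sum (f := fun i : ℕ => ‖g i‖) (fun _ _ => norm_nonneg _)
      (Finset.mem_range.2 (by omega))
  · intro hsum
    -- Since `μ` is unimodular, the modulus is constant along each residue class; summability would
    -- make it zero and force `v = 0`.
    have hz : ∀ i : ℕ, i < p → g i = 0 := by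
      intro i hi
      have h1 : Tendsto (fun m : ℕ => p * m + i + 1) atTop atTop :=
        
        tendsto_atTop_mono (fun m => by simp only [id]; nlinarith [Nat.zero_le m]) tendsto_id
      have h2 := hsum.tendsto_atTop_zero.comp h1
      have h3 : (fun n : ℕ => ‖blochFun p μ g n‖ ^ 2) ∘ (fun m : ℕ => p * m + i + 1)
          = fun _ => ‖g i‖ ^ 2 := by
        ext m
        simp only [Function.comp_apply]
        push_cast
        rw [blochFun_apply hp _ _ (by omega) (by omega), norm_mul, norm_zpow, hμ1, one_zpow,
          one_mul]
      have h4 := tendsto_nhds_unique (by rwa [h3] at h2) tendsto_const_nhds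
      simpa using h4.symm
    have h0 : v 0 = 0 := by simpa [g, hS0, hS1] using hz 0 (by omega)
    have h1 : v 1 = 0 := by
      have h2 := hz (p - 1) (by omega)
      rw [Nat.cast_sub hp, Nat.cast_one] at h2
      rw [h2, mul_zero, mul_eq_zero, or_iff_right hμ0] at hg1
      simpa [g, hS1, hS2, hs.ne'] using hg1
    exact hv0 (by ext i; fin_cases i <;> simp [h0, h1])

/-! ### The discriminant in the variable `2 cos k` -/

theorem chebyshevS_growth {x : ℝ} (hx : 2 ≤ x) (n : ℕ) :
    0 ≤ (Chebyshev.S ℝ ((n : ℤ) - 1)).eval x ∧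
      (Chebyshev.S ℝ ((n : ℤ) - 1)).eval x + 1 ≤ (Chebyshev.S ℝ (n : ℤ)).eval x := by
  induction n with
  | zero => simp
  | succ n ih =>
    have h := chebyshevS_eval_succ ℝ x n
    rw [Nat.cast_succ, h, add_sub_cancel_right]
    constructor <;> nlinarith

theorem chebyshevS_eval_neg (x : ℝ) (n : ℕ) :
    (Chebyshev.S ℝ (n : ℤ)).eval (-x) = (-1) ^ n * (Chebyshev.S ℝ (n : ℤ)).eval x ∧
      (Chebyshev.S ℝ ((n : ℤ) - 1)).eval (-x)
        = -((-1) ^ n * (Chebyshev.S ℝ ((n : ℤ) - 1)).eval x) := by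
  induction n with
  | zero => simp
  | succ n ih =>
    have h := chebyshevS_eval_succ ℝ x n
    have h' := chebyshevS_eval_succ ℝ (-x) n
    rw [Nat.cast_succ, h, h', add_sub_cancel_right, ih.1, ih.2, pow_succ]
    constructor <;> ring

/-- For `x ≥ 2` two growth steps give `S_p ≥ S_{p-2} + 2`, so `D ≥ 2 > 2s`; parity handles `x ≤ -2`.
This justifies the substitution `x = 2 cos k` with `0 < k < π`. -/
theorem two_mul_lt_abs_discrPoly {p : ℕ} (hp : 1 ≤ p) {s : ℝ} (hs0 : 0 < s) (hs1 : s < 1) {x : ℝ}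
    (hx : 2 ≤ |x|) : 2 * s < |(discrPoly ℝ p s).eval x| := by
  obtain ⟨n, rfl⟩ : ∃ n, p = n + 1 := ⟨p - 1, by omega⟩
  have hD (y : ℝ) : (discrPoly ℝ (n + 1) s).eval y = (Chebyshev.S ℝ ((n : ℤ) + 1)).eval y
      - s ^ 2 * (Chebyshev.S ℝ ((n : ℤ) - 1)).eval y := by
    rw [discrPoly, Nat.cast_succ, show (n : ℤ) + 1 - 2 = n - 1 by ring]
    simp
  have hpos : ∀ y : ℝ, 2 ≤ y → 2 * s < (discrPoly ℝ (n + 1) s).eval y := by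
    intro y hy
    have h1 := chebyshevS_growth hy n
    have h2 := chebyshevS_growth hy (n + 1)
    rw [Nat.cast_succ, add_sub_cancel_right] at h2
    rw [hD]
    nlinarith [mul_nonneg h1.1 (show 0 ≤ 1 - s ^ 2 by nlinarith)]
  rcases le_abs.1 hx with h | h
  · exact (hpos x h).trans_le (le_abs_self _)
  · refine (hpos _ h).trans_le ((le_abs_self _).trans (le_of_eq ?_))
    have h1 := chebyshevS_eval_neg x n
    have h2 := chebyshevS_eval_neg x (n + 1)
    rw [Nat.cast_succ] at h2
    rw [hD, hD, h2.1, h1.2, pow_succ]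
    have h3 : |(-1 : ℝ) ^ n| = 1 := by simp
    rw [show ∀ A B : ℝ, (-1) ^ n * -1 * A - s ^ 2 * -((-1) ^ n * B)
      = (-1) ^ n * -(A - s ^ 2 * B) by intros; ring, abs_mul, abs_neg, h3, one_mul]

/-! ### Trigonometry of the phase function. -/

theorem cos_two_mul_arctan_div {x y : ℝ} (hx : x ≠ 0) :
    (x ^ 2 + y ^ 2) * Real.cos (2 * Real.arctan (y / x)) = x ^ 2 - y ^ 2 := by
  have h := Real.cos_sq_arctan (y / x)
  have h0 : x ^ 2 + y ^ 2 ≠ 0 := by positivity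
  rw [Real.cos_two_mul, h]
  field_simp
  ring

theorem sin_two_mul_arctan_div {x y : ℝ} (hx : x ≠ 0) :
    (x ^ 2 + y ^ 2) * Real.sin (2 * Real.arctan (y / x)) = 2 * x * y := by
  have h := Real.cos_sq_arctan (y / x)
  have h0 : x ^ 2 + y ^ 2 ≠ 0 := by positivity
  have h1 := Real.tan_mul_cos (Real.cos_arctan_pos (y / x)).ne'
  rw [Real.tan_arctan] at h1
  rw [Real.sin_two_mul, ← h1, show ∀ a b : ℝ, 2 * (a * b) * b = 2 * a * b ^ 2 by intros; ring, h]
  field_simp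

/-- For points less than `π` apart, the sines have opposite signs exactly when a zero of the sine
lies strictly between them. -/
theorem sin_mul_sin_nonneg_iff {x y : ℝ} (h1 : x < y) (h2 : y < x + Real.pi) :
    0 ≤ Real.sin x * Real.sin y ↔ ∃ j : ℤ, j * Real.pi ≤ x ∧ y ≤ (j + 1) * Real.pi := by
  have hs (j : ℤ) : Real.sin x * Real.sin y
      = Real.sin (x - j * Real.pi) * Real.sin (y - j * Real.pi) := by
    have h : ((-1 : ℝ) ^ j) * (-1) ^ j = 1 := by rw [← mul_zpow]; norm_num
    rw [Real.sin_sub_int_mul_pi, Real.sin_sub_int_mul_pi]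
    linear_combination (-(Real.sin x * Real.sin y)) * h
  constructor
  · intro h
    refine ⟨⌊x / Real.pi⌋, ?_, ?_⟩
    · rw [← le_div_iff₀ Real.pi_pos]
      exact Int.floor_le _
    · by_contra! hy
      have hx1 := (le_div_iff₀ Real.pi_pos).1 (Int.floor_le (x / Real.pi))
      have hx2 := (div_lt_iff₀ Real.pi_pos).1 (Int.lt_floor_add_one (x / Real.pi))
      rw [hs ⌊x / Real.pi⌋] at h
      generalize (⌊x / Real.pi⌋ : ℝ) = j at *
      have e1 : 0 < Real.sin (x - j * Real.pi) := Real.sin_pos_of_pos_of_lt_pi (by linarith)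
        (by linarith)
      have e2 : 0 < Real.sin (y - j * Real.pi - Real.pi) :=
        Real.sin_pos_of_pos_of_lt_pi (by linarith) (by linarith)
      rw [Real.sin_sub_pi] at e2
      nlinarith
  · rintro ⟨j, hj1, hj2⟩
    rw [hs j]
    exact mul_nonneg (Real.sin_nonneg_of_nonneg_of_le_pi (by linarith) (by linarith))
      (Real.sin_nonneg_of_nonneg_of_le_pi (by linarith) (by linarith))

/-- The phase whose values at multiples of `π / 2` give the band edges. -/
noncomputable def bandPhase (p : ℕ) (s k : ℝ) : ℝ :=
  (p + 1) * k / 2 - Real.arctan (s * Real.sin k / (1 + s * Real.cos k))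

section Phase

variable {p : ℕ} {s : ℝ}

theorem one_add_mul_cos_pos (hs0 : 0 < s) (hs1 : s < 1) (k : ℝ) : 0 < 1 + s * Real.cos k := by
  nlinarith [Real.neg_one_le_cos k]

/-- Let `P = sin((p+1)k) + s² sin((p-1)k)`. Up to the positive factors `|1 ± s e^{ik}|²`, the two
sines are `-(P - 2s sin pk)` and `P + 2s sin pk`, and their product is `sin² k (4s² - D²)`. -/
theorem abs_discrPoly_le_iff (hs0 : 0 < s) (hs1 : s < 1) {k : ℝ} (hk0 : 0 < k)
    (hk1 : k < Real.pi) :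
    |(discrPoly ℝ p s).eval (2 * Real.cos k)| ≤ 2 * s ↔
      0 ≤ Real.sin (p * Real.pi - 2 * bandPhase p s (Real.pi - k))
        * Real.sin (2 * bandPhase p s k) := by
  have hsin : 0 < Real.sin k := Real.sin_pos_of_pos_of_lt_pi hk0 hk1
  have hx := one_add_mul_cos_pos hs0 hs1 k
  have hx' := one_add_mul_cos_pos hs0 hs1 (Real.pi - k)
  rw [Real.cos_pi_sub] at hx'
  have c1 := cos_two_mul_arctan_div (y := s * Real.sin k) hx.ne'
  have s1 := sin_two_mul_arctan_div (y := s * Real.sin k) hx.ne'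
  have c2 := cos_two_mul_arctan_div (y := s * Real.sin k) hx'.ne'
  have s2 := sin_two_mul_arctan_div (y := s * Real.sin k) hx'.ne'
  have e1 : 2 * bandPhase p s k = (p * k + k)
      - 2 * Real.arctan (s * Real.sin k / (1 + s * Real.cos k)) := by
    rw [bandPhase]; ring
  have e2 : p * Real.pi - 2 * bandPhase p s (Real.pi - k) = (p * k + k)
      + 2 * Real.arctan (s * Real.sin k / (1 + s * -Real.cos k)) - Real.pi := by
    rw [bandPhase, Real.sin_pi_sub, Real.cos_pi_sub]; ring
  have hD : (discrPoly ℝ p s).eval (2 * Real.cos k) * Real.sin k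
      = Real.sin (p * k + k) - s ^ 2 * Real.sin (p * k - k) := by
    have h1 := Chebyshev.S_two_mul_real_cos k p
    have h2 := Chebyshev.S_two_mul_real_cos k (p - 2)
    push_cast at h1 h2
    rw [show ((p : ℝ) + 1) * k = p * k + k by ring] at h1
    rw [show ((p : ℝ) - 2 + 1) * k = p * k - k by ring] at h2
    simp only [discrPoly, eval_sub, eval_mul, eval_C]
    linear_combination h1 - s ^ 2 * h2
  rw [e1, e2, Real.sin_sub_pi, Real.sin_sub, Real.sin_add (p * k + k)]
  rw [Real.sin_add, Real.sin_sub] at hD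
  rw [Real.sin_add, Real.cos_add]
  have hsc := Real.sin_sq_add_cos_sq k
  have hsc' := Real.sin_sq_add_cos_sq (p * k)
  have hN : 0 < (1 + s * Real.cos k) ^ 2 + (s * Real.sin k) ^ 2 := by positivity
  have hN' : 0 < (1 + s * -Real.cos k) ^ 2 + (s * Real.sin k) ^ 2 := by positivity
  generalize 2 * Real.arctan (s * Real.sin k / (1 + s * Real.cos k)) = u at *
  generalize 2 * Real.arctan (s * Real.sin k / (1 + s * -Real.cos k)) = v at *
  generalize (discrPoly ℝ p s).eval (2 * Real.cos k) = D at *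
  generalize Real.sin (p * k) = A at *
  generalize Real.cos (p * k) = B at *
  generalize Real.sin k = S at *
  generalize Real.cos k = T at *
  have g1 : ((1 + s * T) ^ 2 + (s * S) ^ 2) *
      ((A * T + B * S) * Real.cos u - (B * T - A * S) * Real.sin u)
      = (A * T + B * S) + 2 * s * A + s ^ 2 * (A * T - B * S) := by
    linear_combination (A * T + B * S) * c1 - (B * T - A * S) * s1
      + (2 * s * A + s ^ 2 * (A * T - B * S)) * hsc
  have g2 : ((1 + s * -T) ^ 2 + (s * S) ^ 2) *
      ((A * T + B * S) * Real.cos v + (B * T - A * S) * Real.sin v)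
      = (A * T + B * S) - 2 * s * A + s ^ 2 * (A * T - B * S) := by
    linear_combination (A * T + B * S) * c2 + (B * T - A * S) * s2
      + (-2 * s * A + s ^ 2 * (A * T - B * S)) * hsc
  have key : ((1 + s * -T) ^ 2 + (s * S) ^ 2) * ((1 + s * T) ^ 2 + (s * S) ^ 2) *
      (-((A * T + B * S) * Real.cos v + (B * T - A * S) * Real.sin v) *
        ((A * T + B * S) * Real.cos u - (B * T - A * S) * Real.sin u))
      = S ^ 2 * ((2 * s) ^ 2 - D ^ 2) := by
    rw [show ∀ a b c d : ℝ, a * b * (-c * d) = -((a * c) * (b * d)) by intros; ring, g1, g2]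
    have hD2 : D ^ 2 * S ^ 2 = (A * T + B * S - s ^ 2 * (A * T - B * S)) ^ 2 := by
      rw [← hD]; ring
    linear_combination hD2 + 4 * s ^ 2 * S ^ 2 * hsc' - 4 * s ^ 2 * A ^ 2 * hsc
  rw [← mul_nonneg_iff_of_pos_left (mul_pos hN' hN), key,
    mul_nonneg_iff_of_pos_left (by positivity), sub_nonneg, sq_le_sq,
    abs_of_pos (show 0 < 2 * s by positivity)]

/-- The two phases differ by `π` minus twice a sum of two positive arctangents. Their arguments have
product less than 1 because `s < 1`, so that sum is below `π / 2`. -/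
theorem bandPhase_reflect_lt (hs0 : 0 < s) (hs1 : s < 1) {k : ℝ} (hk0 : 0 < k)
    (hk1 : k < Real.pi) :
    p * Real.pi - 2 * bandPhase p s (Real.pi - k) < 2 * bandPhase p s k ∧
    2 * bandPhase p s k < p * Real.pi - 2 * bandPhase p s (Real.pi - k) + Real.pi := by
  have hsin : 0 < Real.sin k := Real.sin_pos_of_pos_of_lt_pi hk0 hk1
  have hx := one_add_mul_cos_pos hs0 hs1 k
  have hx' := one_add_mul_cos_pos hs0 hs1 (Real.pi - k)
  rw [bandPhase, bandPhase, Real.sin_pi_sub]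
  have h1 : 0 < s * Real.sin k / (1 + s * Real.cos k) := by positivity
  have h2 : 0 < s * Real.sin k / (1 + s * Real.cos (Real.pi - k)) := by positivity
  have h3 : s * Real.sin k / (1 + s * Real.cos k)
      * (s * Real.sin k / (1 + s * Real.cos (Real.pi - k))) < 1 := by
    rw [div_mul_div_comm, div_lt_one (by positivity), Real.cos_pi_sub]
    have h : s ^ 2 * (Real.sin k ^ 2 + Real.cos k ^ 2) = s ^ 2 := by
      rw [Real.sin_sq_add_cos_sq, mul_one]
    nlinarith
  have h4 := Real.arctan_add h3
  have h5 := Real.arctan_lt_pi_div_two ((s * Real.sin k / (1 + s * Real.cos k)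
    + s * Real.sin k / (1 + s * Real.cos (Real.pi - k))) / (1 - s * Real.sin k /
      (1 + s * Real.cos k) * (s * Real.sin k / (1 + s * Real.cos (Real.pi - k)))))
  rw [← h4] at h5
  have h6 := Real.arctan_pos.2 h1
  have h7 := Real.arctan_pos.2 h2
  constructor <;> linarith

theorem bandPhase_zero : bandPhase p s 0 = 0 := by simp [bandPhase]

theorem bandPhase_pi : bandPhase p s Real.pi = Real.pi * (p + 1) / 2 := by
  simp [bandPhase, mul_comm]

theorem bandPhase_continuous (hs0 : 0 < s) (hs1 : s < 1) : Continuous (bandPhase p s) := by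
  unfold bandPhase
  exact ((continuous_const.mul continuous_id).div_const 2).sub (Real.continuous_arctan.comp
    ((continuous_const.mul Real.continuous_sin).div
      (continuous_const.add (continuous_const.mul Real.continuous_cos))
      fun k => (one_add_mul_cos_pos hs0 hs1 k).ne'))

/-- The argument of `1 + s e^{ik}` has derivative `(s cos k + s²) / |1 + s e^{ik}|² < 1`, while the
linear term has slope `(p + 1) / 2 ≥ 1`. -/
theorem bandPhase_strictMono (hp : 1 ≤ p) (hs0 : 0 < s) (hs1 : s < 1) :
    StrictMono (bandPhase p s) := by
  refine strictMono_of_deriv_pos fun k => ?_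
  have hx := one_add_mul_cos_pos hs0 hs1 k
  have h1 : HasDerivAt (fun k => s * Real.sin k / (1 + s * Real.cos k))
      ((s * Real.cos k * (1 + s * Real.cos k) - s * Real.sin k * (s * -Real.sin k))
        / (1 + s * Real.cos k) ^ 2) k :=
    ((Real.hasDerivAt_sin k).const_mul s).div
      (((Real.hasDerivAt_cos k).const_mul s).const_add 1) hx.ne'
  have h2 : HasDerivAt (fun k : ℝ => ((p : ℝ) + 1) * k / 2) (((p : ℝ) + 1) * 1 / 2) k :=
    ((hasDerivAt_id k).const_mul _).div_const 2
  have h3 : HasDerivAt (bandPhase p s) _ k := h2.sub h1.arctan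
  rw [h3.deriv]
  have hsc := Real.sin_sq_add_cos_sq k
  have hp' : (1 : ℝ) ≤ p := by exact_mod_cast hp
  have h4 : 1 / (1 + (s * Real.sin k / (1 + s * Real.cos k)) ^ 2) *
      ((s * Real.cos k * (1 + s * Real.cos k) - s * Real.sin k * (s * -Real.sin k))
        / (1 + s * Real.cos k) ^ 2) < 1 := by
    have e : 1 / (1 + (s * Real.sin k / (1 + s * Real.cos k)) ^ 2) *
      ((s * Real.cos k * (1 + s * Real.cos k) - s * Real.sin k * (s * -Real.sin k))
        / (1 + s * Real.cos k) ^ 2) =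
      (s * Real.cos k + s ^ 2 * (Real.sin k ^ 2 + Real.cos k ^ 2))
        / ((1 + s * Real.cos k) ^ 2 + (s * Real.sin k) ^ 2) := by
      field_simp
      ring
    rw [e, div_lt_one (by positivity), hsc]
    nlinarith
  linarith

theorem bandPhase_surjective (hs0 : 0 < s) (hs1 : s < 1) :
    Function.Surjective (bandPhase p s) := by
  have hp : (0 : ℝ) ≤ p := Nat.cast_nonneg p
  refine (bandPhase_continuous hs0 hs1).surjective ?_ ?_
  · refine tendsto_atTop_mono' atTop (f₁ := fun k => k / 2 - Real.pi / 2) ?_ ?_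
    · filter_upwards [eventually_ge_atTop 0] with k hk
      have := Real.arctan_lt_pi_div_two (s * Real.sin k / (1 + s * Real.cos k))
      have := mul_nonneg hp hk
      rw [bandPhase]
      linarith
    · exact tendsto_atTop_add_const_right _ _ (tendsto_id.atTop_div_const two_pos)
  · refine tendsto_atBot_mono' atBot (f₁ := fun k => k / 2 + Real.pi / 2) ?_ ?_
    · filter_upwards [eventually_le_atBot 0] with k hk
      have := Real.neg_pi_div_two_lt_arctan (s * Real.sin k / (1 + s * Real.cos k))
      have := mul_nonpos_of_nonneg_of_nonpos hp hk
      rw [bandPhase]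
      linarith
    · exact tendsto_atBot_add_const_right _ _ (tendsto_id.atBot_div_const two_pos)

end Phase

/-! ### Gaps of a finite union of separated intervals -/

section Bands

variable {n : ℕ} {l u : ℕ → ℝ}

theorem band_upper_lt_lower (hlu : ∀ i ≤ n, l i ≤ u i) (hul : ∀ i < n, u i < l (i + 1)) {i j : ℕ}
    (hij : i < j) (hj : j ≤ n) : u i < l j := by
  induction j with
  | zero => omega
  | succ j ih =>
    rcases (Nat.lt_succ_iff.1 hij).eq_or_lt with rfl | h
    · exact hul _ (by omega)
    · exact (ih h (by omega)).trans_le ((hlu j (by omega)).trans (hul j (by omega)).le)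

theorem isGap_bands_iff (hlu : ∀ i ≤ n, l i ≤ u i) (hul : ∀ i < n, u i < l (i + 1)) {g : ℝ × ℝ} :
    IsGap {x | ∃ i ≤ n, l i ≤ x ∧ x ≤ u i} g ↔ ∃ i < n, g = (u i, l (i + 1)) := by
  have hlt {i j : ℕ} (hij : i < j) (hj : j ≤ n) : u i < l j :=
    band_upper_lt_lower hlu hul hij hj
  have huu {i j : ℕ} (hij : i ≤ j) (hj : j ≤ n) : u i ≤ u j := by
    rcases hij.eq_or_lt with rfl | h
    · rfl
    · exact (hlt h hj).le.trans (hlu j hj)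
  have hll {i j : ℕ} (hij : i ≤ j) (hj : j ≤ n) : l i ≤ l j := by
    rcases hij.eq_or_lt with rfl | h
    · rfl
    · exact (hlu i (by omega)).trans (hlt h hj).le
  constructor
  · obtain ⟨x, y⟩ := g
    rintro ⟨hxy, ⟨i, hi, hix, hxi⟩, ⟨j, hj, hjy, hyj⟩, hdisj⟩
    rw [Set.disjoint_left] at hdisj
    dsimp only at *
    obtain rfl : x = u i := by
      refine le_antisymm hxi (not_lt.1 fun h => ?_)
      have h1 : x < min (u i) ((x + y) / 2) := lt_min h (by linarith)
      exact hdisj ⟨h1, (min_le_right _ _).trans_lt (by linarith)⟩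
        ⟨i, hi, hix.trans h1.le, min_le_left _ _⟩
    have hij : i < j := by
      by_contra! h
      linarith [huu h hi]
    refine ⟨i, by omega, Prod.ext rfl (le_antisymm (not_lt.1 fun h => ?_) ?_)⟩
    · exact hdisj ⟨hul i (by omega), h⟩ ⟨i + 1, by omega, le_rfl, hlu _ (by omega)⟩
    · exact (hll hij hj).trans hjy
  · rintro ⟨i, hi, rfl⟩
    refine ⟨hul i hi, ⟨i, hi.le, hlu i hi.le, le_rfl⟩, ⟨i + 1, hi, le_rfl, hlu _ hi⟩, ?_⟩
    rw [Set.disjoint_left]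
    rintro x ⟨h1, h2⟩ ⟨j, hj, h3, h4⟩
    dsimp only at h1 h2
    rcases le_or_gt j i with h | h
    · linarith [huu h hi.le]
    · linarith [hll h hj]

theorem totalGapLength_bands (hlu : ∀ i ≤ n, l i ≤ u i) (hul : ∀ i < n, u i < l (i + 1)) :
    totalGapLength {x | ∃ i ≤ n, l i ≤ x ∧ x ≤ u i}
      = ∑ i ∈ Finset.range n, (l (i + 1) - u i) := by
  let f (i : Fin n) : {g : ℝ × ℝ // IsGap {x | ∃ i ≤ n, l i ≤ x ∧ x ≤ u i} g} :=
    ⟨(u i, l (i + 1)), (isGap_bands_iff hlu hul).2 ⟨i, i.2, rfl⟩⟩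
  have huu {i j : ℕ} (hij : i < j) (hj : j < n) : u i < u j :=
    (band_upper_lt_lower hlu hul hij hj.le).trans_le (hlu j hj.le)
  have hf : Function.Bijective f := by
    constructor
    · intro i j hij
      have h : u i = u j := congrArg (fun g => g.1.1) hij
      ext
      rcases lt_trichotomy (i : ℕ) j with h1 | h1 | h1
      · exact absurd h (huu h1 j.2).ne
      · exact h1
      · exact absurd h (huu h1 i.2).ne'
    · rintro ⟨g, hg⟩
      obtain ⟨i, hi, rfl⟩ := (isGap_bands_iff hlu hul).1 hg
      exact ⟨⟨i, hi⟩, rfl⟩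
  rw [totalGapLength, ← (Equiv.ofBijective f hf).tsum_eq, tsum_fintype,
    ENNReal.toReal_sum fun _ _ => ENNReal.ofReal_ne_top, Finset.sum_range]
  exact Finset.sum_congr rfl fun i _ => ENNReal.toReal_ofReal (sub_nonneg.2 (hul i i.2).le)

end Bands

/-! ### The band structure of the spectrum -/

/-- The point at which `bandPhase p s` takes the value `π j / 2`. -/
noncomputable def bandEdge (p : ℕ) (s : ℝ) (j : ℕ) : ℝ :=
  Function.invFun (bandPhase p s) (Real.pi * j / 2)

section Edges

variable {p : ℕ} {s : ℝ}

theorem bandPhase_bandEdge (hs0 : 0 < s) (hs1 : s < 1) (j : ℕ) :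
    bandPhase p s (bandEdge p s j) = Real.pi * j / 2 :=
  Function.rightInverse_invFun (bandPhase_surjective hs0 hs1) _

theorem le_bandEdge_iff (hp : 1 ≤ p) (hs0 : 0 < s) (hs1 : s < 1) {j : ℕ} {k : ℝ} :
    k ≤ bandEdge p s j ↔ bandPhase p s k ≤ Real.pi * j / 2 := by
  rw [← bandPhase_bandEdge hs0 hs1 j, (bandPhase_strictMono hp hs0 hs1).le_iff_le]

theorem bandEdge_pos (hp : 1 ≤ p) (hs0 : 0 < s) (hs1 : s < 1) {j : ℕ} (hj : 0 < j) :
    0 < bandEdge p s j := by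
  rw [← (bandPhase_strictMono hp hs0 hs1).lt_iff_lt, bandPhase_bandEdge hs0 hs1, bandPhase_zero]
  have := Real.pi_pos
  positivity

theorem bandEdge_lt_pi (hp : 1 ≤ p) (hs0 : 0 < s) (hs1 : s < 1) {j : ℕ} (hj : j ≤ p) :
    bandEdge p s j < Real.pi := by
  rw [← (bandPhase_strictMono hp hs0 hs1).lt_iff_lt, bandPhase_bandEdge hs0 hs1, bandPhase_pi]
  have : (j : ℝ) ≤ p := by exact_mod_cast hj
  have := Real.pi_pos
  gcongr
  linarith

theorem cos_le_neg_cos_iff {x y : ℝ} (hx0 : 0 ≤ x) (hx1 : x ≤ Real.pi) (hy0 : 0 ≤ y)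
    (hy1 : y ≤ Real.pi) : Real.cos x ≤ -Real.cos y ↔ Real.pi - y ≤ x := by
  rw [← Real.cos_pi_sub]
  exact Real.strictAntiOn_cos.le_iff_ge ⟨hx0, hx1⟩ ⟨by linarith, by linarith⟩

theorem abs_discrPoly_le_iff_mem_bands (hs0 : 0 < s) (hs1 : s < 1) (n : ℕ) (x : ℝ) :
    |(discrPoly ℝ (n + 1) s).eval x| ≤ 2 * s ↔
      ∃ i ≤ n, 2 * Real.cos (bandEdge (n + 1) s (n + 1 - i)) ≤ x ∧
        x ≤ -(2 * Real.cos (bandEdge (n + 1) s (i + 1))) := by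
  have hp : 1 ≤ n + 1 := by omega
  have hpi := Real.pi_pos
  rcases le_or_gt 2 |x| with hx | hx
  · refine iff_of_false (not_le.2 (two_mul_lt_abs_discrPoly hp hs0 hs1 hx)) ?_
    rintro ⟨i, hi, h1, h2⟩
    have hc {j : ℕ} (h0 : 0 < j) (hj : j ≤ n + 1) :
        -1 < Real.cos (bandEdge (n + 1) s j) := by
      rw [← Real.cos_pi]
      exact Real.cos_lt_cos_of_nonneg_of_le_pi (bandEdge_pos hp hs0 hs1 h0).le le_rfl
        (bandEdge_lt_pi hp hs0 hs1 hj)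
    have h3 := hc (show 0 < n + 1 - i by omega) (by omega)
    have h4 := hc (show 0 < i + 1 by omega) (by omega)
    exact absurd hx (not_le.2 (abs_lt.2 ⟨by linarith, by linarith⟩))
  obtain ⟨k, hk0, hk1, rfl⟩ : ∃ k, 0 < k ∧ k < Real.pi ∧ x = 2 * Real.cos k := by
    rw [abs_lt] at hx
    refine ⟨Real.arccos (x / 2), Real.arccos_pos.2 (by linarith),
      Real.arccos_lt_pi.2 (by linarith), ?_⟩
    rw [Real.cos_arccos (by linarith) (by linarith)]
    ring
  obtain ⟨h1, h2⟩ := bandPhase_reflect_lt (p := n + 1) hs0 hs1 hk0 hk1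
  have h0 : 0 < bandPhase (n + 1) s k := by
    rw [← bandPhase_zero (p := n + 1) (s := s)]
    exact bandPhase_strictMono hp hs0 hs1 hk0
  have h0' : 0 < bandPhase (n + 1) s (Real.pi - k) := by
    rw [← bandPhase_zero (p := n + 1) (s := s)]
    exact bandPhase_strictMono hp hs0 hs1 (by linarith)
  have hband (i : ℕ) (hi : i ≤ n) :
      (2 * Real.cos (bandEdge (n + 1) s (n + 1 - i)) ≤ 2 * Real.cos k ∧
        2 * Real.cos k ≤ -(2 * Real.cos (bandEdge (n + 1) s (i + 1)))) ↔
      ((n - i : ℝ) * Real.pi ≤ (n + 1 : ℕ) * Real.pi - 2 * bandPhase (n + 1) s (Real.pi - k) ∧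
        2 * bandPhase (n + 1) s k ≤ (n - i + 1) * Real.pi) := by
    have e1 : 2 * Real.cos (bandEdge (n + 1) s (n + 1 - i)) ≤ 2 * Real.cos k ↔
        k ≤ bandEdge (n + 1) s (n + 1 - i) := by
      rw [mul_le_mul_iff_right₀ two_pos]
      exact Real.strictAntiOn_cos.le_iff_ge ⟨(bandEdge_pos hp hs0 hs1 (by omega)).le,
        (bandEdge_lt_pi hp hs0 hs1 (by omega)).le⟩ ⟨hk0.le, hk1.le⟩
    have e2 : 2 * Real.cos k ≤ -(2 * Real.cos (bandEdge (n + 1) s (i + 1))) ↔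
        Real.pi - k ≤ bandEdge (n + 1) s (i + 1) := by
      rw [← mul_neg, mul_le_mul_iff_right₀ two_pos, le_neg]
      exact cos_le_neg_cos_iff (bandEdge_pos hp hs0 hs1 (by omega)).le
        (bandEdge_lt_pi hp hs0 hs1 (by omega)).le hk0.le hk1.le
    rw [e1, e2, le_bandEdge_iff hp hs0 hs1, le_bandEdge_iff hp hs0 hs1,
      Nat.cast_sub (by omega : i ≤ n + 1)]
    push_cast
    constructor <;> rintro ⟨h1, h2⟩ <;> constructor <;> linarith
  rw [abs_discrPoly_le_iff hs0 hs1 hk0 hk1, sin_mul_sin_nonneg_iff h1 h2]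
  constructor
  -- Positivity of the phase at `k` and at `π - k` confines `j` to `0, …, n`. The band index is `n -
  -- j` because cosine reverses the order.
  · rintro ⟨j, hj1, hj2⟩
    have hj0 : 0 < j + 1 := by
      have : (0 : ℝ) < (j + 1 : ℤ) := by
        push_cast
        exact pos_of_mul_pos_left (by linarith) hpi.le
      exact_mod_cast this
    have hjn : j < n + 1 := by
      have : ((j : ℤ) : ℝ) < (n + 1 : ℕ) := lt_of_mul_lt_mul_right (by linarith) hpi.le
      exact_mod_cast this
    lift j to ℕ using by omega
    refine ⟨n - j, by omega, (hband _ (by omega)).2 ?_⟩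
    rw [Nat.cast_sub (by omega : j ≤ n), sub_sub_cancel]
    exact ⟨hj1, hj2⟩
  · rintro ⟨i, hi, h⟩
    refine ⟨n - i, ?_⟩
    push_cast
    have := (hband i hi).1 h
    push_cast at this
    exact this

theorem gapSum_eq {c : ℝ} (hc0 : 0 < c) (hc1 : c < 1) (n : ℕ) :
    gapSum (n + 1) c = ∑ i ∈ Finset.range n,
      (2 * Real.cos (bandEdge (n + 1) (1 - c) (n - i))
        + 2 * Real.cos (bandEdge (n + 1) (1 - c) (i + 1))) := by
  have hp : 1 ≤ n + 1 := by omega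
  have hs0 : 0 < 1 - c := by linarith
  have hs1 : 1 - c < 1 := by linarith
  have hpi := Real.pi_pos
  have hspec : jacobiSpectrum (perturbedSeq (n + 1) c) (fun _ => 0)
      (isBoundedSeq_perturbedSeq (n + 1) c) isBoundedSeq_zero
      = {x | ∃ i ≤ n, 2 * Real.cos (bandEdge (n + 1) (1 - c) (n + 1 - i)) ≤ x ∧
        x ≤ -(2 * Real.cos (bandEdge (n + 1) (1 - c) (i + 1)))} := by
    ext x
    rw [Set.mem_ofPred_eq, ← abs_discrPoly_le_iff_mem_bands hs0 hs1]
    exact ⟨abs_discrPoly_le_of_mem_spectrum hp hs0 _ _ (fun _ => rfl) (fun _ => rfl),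
      mem_jacobiSpectrum_of_abs_discrPoly_le hp hs0 _ _ (fun _ => rfl) (fun _ => rfl)⟩
  -- At the edge `α_{i+1}` the upper bound shows that band `i` is non-empty, and the lower bound
  -- that the gap above it is open.
  have hrefl (i : ℕ) (hi : i ≤ n) := bandPhase_reflect_lt (p := n + 1) hs0 hs1
    (bandEdge_pos hp hs0 hs1 (show 0 < i + 1 by omega)) (bandEdge_lt_pi hp hs0 hs1 (by omega))
  have hiff (i j : ℕ) (hi : i ≤ n) (hj0 : 0 < j) (hj : j ≤ n + 1) :
      2 * Real.cos (bandEdge (n + 1) (1 - c) j)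
        ≤ -(2 * Real.cos (bandEdge (n + 1) (1 - c) (i + 1))) ↔
      bandPhase (n + 1) (1 - c) (Real.pi - bandEdge (n + 1) (1 - c) (i + 1))
        ≤ Real.pi * j / 2 := by
    rw [← mul_neg, mul_le_mul_iff_right₀ two_pos, ← le_bandEdge_iff hp hs0 hs1]
    exact cos_le_neg_cos_iff (bandEdge_pos hp hs0 hs1 hj0).le (bandEdge_lt_pi hp hs0 hs1 hj).le
      (bandEdge_pos hp hs0 hs1 (by omega)).le (bandEdge_lt_pi hp hs0 hs1 (by omega)).le
  rw [gapSum, hspec, totalGapLength_bands]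
  · refine Finset.sum_congr rfl fun i hi => ?_
    rw [Nat.add_sub_add_right, sub_neg_eq_add]
  · intro i hi
    rw [hiff _ _ hi (by omega) (by omega), Nat.cast_sub (by omega)]
    have := (hrefl i hi).2
    rw [bandPhase_bandEdge hs0 hs1] at this
    push_cast at this ⊢
    linarith
  · intro i hi
    rw [← not_le, hiff _ _ hi.le (by omega) (by omega), not_le, Nat.cast_sub (by omega)]
    have := (hrefl i hi.le).1
    rw [bandPhase_bandEdge hs0 hs1] at this
    push_cast at this ⊢
    linarith

end Edges

/-! ### First order asymptotics -/

/-- The number `1 + e^{ik}` has argument `k / 2`, so the left side measures the departure from `s =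
1`; the right side makes its order in `1 - s` visible. -/
theorem half_sub_arctan_eq {s k : ℝ} (hs0 : 0 < s) (hs1 : s < 1) (hk0 : 0 < k)
    (hk1 : k < Real.pi) :
    k / 2 - Real.arctan (s * Real.sin k / (1 + s * Real.cos k))
      = Real.arctan ((1 - s) / (1 + s) * Real.tan (k / 2)) := by
  have hc : 0 < Real.cos (k / 2) := Real.cos_pos_of_mem_Ioo ⟨by linarith, by linarith⟩
  set t := Real.tan (k / 2) with ht
  have h1 : Real.arctan t = k / 2 := Real.arctan_tan (by linarith) (by linarith)
  have hd : 0 < (1 + s) + (1 - s) * t ^ 2 := by nlinarith [sq_nonneg t]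
  have hx : s * Real.sin k / (1 + s * Real.cos k) = 2 * s * t / ((1 + s) + (1 - s) * t ^ 2) := by
    have e1 := Real.sin_two_mul (k / 2)
    have e2 := Real.cos_two_mul' (k / 2)
    have e3 := Real.sin_sq_add_cos_sq (k / 2)
    rw [mul_div_cancel₀ _ two_ne_zero] at e1 e2
    have e4 : Real.sin (k / 2) = t * Real.cos (k / 2) := by
      rw [ht, Real.tan_mul_cos hc.ne']
    rw [div_eq_div_iff (one_add_mul_cos_pos hs0 hs1 k).ne' hd.ne', e1, e2]
    rw [e4] at e3 ⊢
    linear_combination (2 * s * t) * e3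
  have hxy : 0 < (1 + s) * (1 + s + (1 - s) * t ^ 2) - 2 * s * (1 - s) * t ^ 2 := by
    nlinarith [sq_nonneg t, mul_nonneg (sub_nonneg.2 hs1.le) (sq_nonneg t)]
  have hs : 0 < 1 + s := by linarith
  obtain ⟨E, hE⟩ : ∃ E, E = 1 + s + (1 - s) * t ^ 2 := ⟨_, rfl⟩
  rw [hx]
  rw [← hE] at hd hxy ⊢
  have e : 2 * s * t / E * ((1 - s) / (1 + s) * t)
      = 2 * s * (1 - s) * t ^ 2 / ((1 + s) * E) := by
    field_simp
  rw [sub_eq_iff_eq_add', ← h1, Real.arctan_add, e, one_sub_div (by positivity),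
    div_add' _ _ _ hd.ne']
  · congr 1
    rw [div_div_eq_mul_div, eq_div_iff hxy.ne']
    field_simp
    rw [hE]
    ring
  · rw [e, div_lt_one (by positivity)]
    linarith

/-- Chain rule for first order expansions along a filter on which the small parameter is `c`. -/
theorem HasDerivAt.comp_isLittleO {F : Filter ℝ} (hF : Tendsto (fun c : ℝ => c) F (𝓝 0))
    {f h : ℝ → ℝ} {f' x L : ℝ} (hf : HasDerivAt f f' x)
    (hh : (fun c => h c - x - L * c) =o[F] fun c => c) :
    (fun c => f (h c) - f x - f' * L * c) =o[F] fun c => c := by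
  have hL : (fun c : ℝ => L * c) =O[F] fun c => c := isBigO_const_mul_self L _ F
  have hO : (fun c => h c - x) =O[F] fun c => c :=
    (hh.isBigO.add hL).congr_left fun c => by ring
  have ht : Tendsto h F (𝓝 x) := by
    have := (hO.trans_tendsto hF).add_const x
    simpa using this
  have h1 := ((hasDerivAt_iff_isLittleO.1 hf).comp_tendsto ht).trans_isBigO hO
  refine (h1.add (hh.const_mul_left f')).congr_left fun c => ?_
  simp only [Function.comp_apply, smul_eq_mul]
  ring

section Asymptotics

variable {p j : ℕ}

theorem eventually_small : ∀ᶠ c : ℝ in 𝓝[>] 0, 0 < c ∧ c < 1 :=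
  Ioo_mem_nhdsGT one_pos

theorem tendsto_small : Tendsto (fun c : ℝ => c) (𝓝[>] 0) (𝓝 0) :=
  tendsto_id.mono_left nhdsWithin_le_nhds

theorem bandEdge_eq (hp : 1 ≤ p) {c : ℝ} (hc0 : 0 < c) (hc1 : c < 1) (hj0 : 0 < j) (hj : j ≤ p) :
    bandEdge p (1 - c) j = Real.pi * j / p
      - 2 / p * Real.arctan (c / (2 - c) * Real.tan (bandEdge p (1 - c) j / 2)) := by
  have hs0 : 0 < 1 - c := by linarith
  have hs1 : 1 - c < 1 := by linarith
  have hp' : (p : ℝ) ≠ 0 := by positivity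
  have h1 := half_sub_arctan_eq hs0 hs1 (bandEdge_pos hp hs0 hs1 hj0) (bandEdge_lt_pi hp hs0 hs1 hj)
  have h2 := bandPhase_bandEdge (p := p) hs0 hs1 j
  rw [sub_sub_cancel, show 1 + (1 - c) = 2 - c by ring] at h1
  rw [← h1]
  rw [bandPhase] at h2
  field_simp
  linarith

theorem cos_bandEdge_isLittleO (hp : 1 ≤ p) (hj0 : 0 < j) (hj : j < p) :
    (fun c : ℝ => Real.cos (bandEdge p (1 - c) j) - Real.cos (Real.pi * j / p)
      - (1 - Real.cos (Real.pi * j / p)) / p * c) =o[𝓝[>] 0] fun c => c := by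
  have hpi := Real.pi_pos
  have hp' : (0 : ℝ) < p := by positivity
  set κ : ℝ := Real.pi * j / p with hκ
  have hκ0 : 0 < κ := by positivity
  have hκ1 : κ < Real.pi := by
    have : (j : ℝ) < p := by exact_mod_cast hj
    rw [hκ, div_lt_iff₀ hp']
    gcongr
  have hcos : 0 < Real.cos (κ / 2) := Real.cos_pos_of_mem_Ioo ⟨by linarith, by linarith⟩
  have htan : 0 < Real.tan (κ / 2) := Real.tan_pos_of_pos_of_lt_pi_div_two (by linarith)
    (by linarith)
  set y : ℝ → ℝ := fun c => c / (2 - c) * Real.tan (bandEdge p (1 - c) j / 2) with hy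
  -- A priori bound for the implicit equation: the correction is non-negative, so the edge is at
  -- most `κ`, and `κ < π` (from `j < p`) keeps the tangent bounded.
  have hbd : ∀ᶠ c in 𝓝[>] (0 : ℝ), 0 ≤ y c ∧ y c ≤ c * Real.tan (κ / 2) := by
    filter_upwards [eventually_small] with c hc
    have h1 := bandEdge_eq hp hc.1 hc.2 hj0 hj.le
    have h2 := bandEdge_pos hp (by linarith : 0 < 1 - c) (by linarith [hc.1]) hj0
    have h3 := bandEdge_lt_pi hp (by linarith : 0 < 1 - c) (by linarith [hc.1]) hj.le
    have h4 : 0 < 2 - c := by linarith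
    have h5 : 0 < Real.tan (bandEdge p (1 - c) j / 2) :=
      Real.tan_pos_of_pos_of_lt_pi_div_two (by linarith) (by linarith)
    have h6 : 0 ≤ y c := mul_nonneg (div_nonneg hc.1.le h4.le) h5.le
    have h7 : bandEdge p (1 - c) j ≤ κ := by
      rw [h1]
      have : 0 ≤ 2 / (p : ℝ) * Real.arctan (y c) :=
        mul_nonneg (by positivity) (Real.arctan_nonneg.2 h6)
      linarith
    refine ⟨h6, mul_le_mul ?_ ?_ h5.le hc.1.le⟩
    · exact div_le_self hc.1.le (by linarith)
    · rcases h7.eq_or_lt with h | h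
      · rw [h]
      · exact (Real.tan_lt_tan_of_lt_of_lt_pi_div_two (by linarith) (by linarith)
          (by linarith)).le
  have hy0 : Tendsto y (𝓝[>] 0) (𝓝 0) := by
    refine tendsto_of_tendsto_of_tendsto_of_le_of_le' tendsto_const_nhds ?_
      (hbd.mono fun c h => h.1) (hbd.mono fun c h => h.2)
    simpa using tendsto_small.mul_const (Real.tan (κ / 2))
  have hedge : (fun c => κ - 2 / p * Real.arctan (y c)) =ᶠ[𝓝[>] 0]
      fun c => bandEdge p (1 - c) j := by
    filter_upwards [eventually_small] with c hc
    exact (bandEdge_eq hp hc.1 hc.2 hj0 hj.le).symm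
  have hα : Tendsto (fun c => bandEdge p (1 - c) j) (𝓝[>] 0) (𝓝 κ) := by
    refine Tendsto.congr' hedge ?_
    have := ((Real.continuous_arctan.tendsto 0).comp hy0).const_mul (2 / (p : ℝ))
    simpa using this.const_sub κ
  have hyL : (fun c => y c - 0 - Real.tan (κ / 2) / 2 * c) =o[𝓝[>] 0] fun c => c := by
    have h1 : Tendsto (fun c : ℝ => Real.tan (bandEdge p (1 - c) j / 2) / (2 - c)
        - Real.tan (κ / 2) / 2) (𝓝[>] 0) (𝓝 0) := by
      have h2 := ((Real.continuousAt_tan.2 hcos.ne').tendsto.comp (hα.div_const 2)).div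
        (tendsto_small.const_sub 2) (by norm_num)
      simpa using h2.sub_const (Real.tan (κ / 2) / 2)
    have h3 := (isBigO_refl (fun c : ℝ => c) (𝓝[>] 0)).mul_isLittleO
      ((isLittleO_one_iff ℝ).2 h1)
    refine h3.congr (fun c => ?_) (fun c => mul_one c)
    simp only [hy]
    ring
  have h1 := HasDerivAt.comp_isLittleO tendsto_small (Real.hasDerivAt_arctan 0) hyL
  have h2 : (fun c => bandEdge p (1 - c) j - κ - (-(Real.tan (κ / 2) / p)) * c)
      =o[𝓝[>] 0] fun c => c := by
    refine (h1.const_mul_left (-(2 / (p : ℝ)))).congr' ?_ EventuallyEq.rfl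
    filter_upwards [hedge] with c hc
    rw [← hc, Real.arctan_zero]
    ring
  have h3 := HasDerivAt.comp_isLittleO tendsto_small (Real.hasDerivAt_cos κ) h2
  refine h3.congr_left fun c => ?_
  have e1 := Real.sin_two_mul (κ / 2)
  have e2 := Real.cos_two_mul' (κ / 2)
  have e3 := Real.sin_sq_add_cos_sq (κ / 2)
  have e4 := Real.tan_mul_cos hcos.ne'
  rw [mul_div_cancel₀ _ two_ne_zero] at e1 e2
  have e5 : Real.sin κ * Real.tan (κ / 2) = 1 - Real.cos κ := by
    rw [e1, e2]
    linear_combination 2 * Real.sin (κ / 2) * e4 + e3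
  rw [← e5]
  ring

theorem gapSum_isLittleO (hp : 1 ≤ p) :
    (fun c : ℝ => gapSum p c - 4 * ((p : ℝ) - 1) / (p : ℝ) * c) =o[𝓝[>] 0] fun c : ℝ => c := by
  obtain ⟨n, rfl⟩ : ∃ n, p = n + 1 := ⟨p - 1, by omega⟩
  have hgap : ∀ i ∈ Finset.range n, (fun c : ℝ =>
      2 * Real.cos (bandEdge (n + 1) (1 - c) (n - i))
        + 2 * Real.cos (bandEdge (n + 1) (1 - c) (i + 1)) - 4 / ((n + 1 : ℕ) : ℝ) * c)
      =o[𝓝[>] 0] fun c => c := by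
    intro i hi
    rw [Finset.mem_range] at hi
    have h1 := cos_bandEdge_isLittleO (p := n + 1) (j := n - i) hp (by omega) (by omega)
    have h2 := cos_bandEdge_isLittleO (p := n + 1) (j := i + 1) hp (by omega) (by omega)
    -- The indices `n - i` and `i + 1` add up to `p`, so the cosines cancel both at order zero and
    -- in the coefficient of `c`.
    have h3 : Real.cos (Real.pi * ((n - i : ℕ) : ℝ) / ((n + 1 : ℕ) : ℝ))
        = -Real.cos (Real.pi * ((i + 1 : ℕ) : ℝ) / ((n + 1 : ℕ) : ℝ)) := by
      rw [← Real.cos_pi_sub]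
      congr 1
      rw [Nat.cast_sub hi.le]
      push_cast
      field_simp
      ring
    rw [h3] at h1
    refine ((h1.add h2).const_mul_left 2).congr_left fun c => ?_
    ring
  refine (IsLittleO.sum hgap).congr' ?_ EventuallyEq.rfl
  filter_upwards [eventually_small] with c hc
  rw [Finset.sum_apply, Finset.sum_sub_distrib, ← gapSum_eq hc.1 hc.2, Finset.sum_const, Finset.card_range,
    nsmul_eq_mul]
  push_cast
  ring

/-! ### The lower bound and the comparison with the gap sum. -/

theorem gapLowerBound_perturbedSeq (hp : 1 ≤ p) {c : ℝ} (hc : 0 < c) :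
    gapLowerBound p (perturbedSeq p c) = 4 * (1 - c) ^ (1 / (p : ℝ)) - 4 * (1 - c) := by
  have h1 : ∏ n ∈ Finset.Icc 1 p, perturbedSeq p c (n : ℤ) = 1 - c := by
    rw [Finset.prod_eq_single p]
    · simp [perturbedSeq]
    · intro n hn hne
      rw [Finset.mem_Icc] at hn
      rw [perturbedSeq, if_neg]
      intro h
      have := Nat.le_of_dvd (by omega) (Int.natCast_dvd_natCast.1 h)
      omega
    · intro h
      exact absurd (Finset.mem_Icc.2 ⟨hp, le_rfl⟩) h
  have h2 : ⨅ n : ℤ, perturbedSeq p c n = 1 - c := by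
    have hle (n : ℤ) : 1 - c ≤ perturbedSeq p c n := by
      rw [perturbedSeq]
      split_ifs <;> linarith
    refine le_antisymm ?_ (le_ciInf hle)
    exact (ciInf_le ⟨1 - c, Set.forall_mem_range.2 hle⟩ 0).trans (by simp [perturbedSeq])
  rw [gapLowerBound, h1, h2]

theorem gapLowerBound_isLittleO (hp : 1 ≤ p) :
    (fun c : ℝ => gapLowerBound p (perturbedSeq p c) - 4 * ((p : ℝ) - 1) / (p : ℝ) * c)
      =o[𝓝[>] 0] fun c : ℝ => c := by
  have hp' : (p : ℝ) ≠ 0 := by positivity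
  have h0 : HasDerivAt (fun x : ℝ => x ^ (1 / (p : ℝ)))
      (1 / (p : ℝ) * 1 ^ (1 / (p : ℝ) - 1)) 1 := Real.hasDerivAt_rpow_const (Or.inl one_ne_zero)
  have h1 : (fun c : ℝ => (1 - c) - 1 - (-1) * c) =o[𝓝[>] 0] fun c => c :=
    (isLittleO_zero _ _).congr_left fun c => by ring
  have h2 := HasDerivAt.comp_isLittleO tendsto_small h0 h1
  refine (h2.const_mul_left 4).congr' ?_ EventuallyEq.rfl
  filter_upwards [eventually_small] with c hc
  rw [gapLowerBound_perturbedSeq hp hc.1, Real.one_rpow, Real.one_rpow]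
  field_simp
  ring

theorem gapSum_isEquivalent_gapLowerBound (hp : 1 ≤ p) :
    (fun c : ℝ => gapSum p c) ~[𝓝[>] 0] fun c : ℝ => gapLowerBound p (perturbedSeq p c) := by
  rcases hp.eq_or_lt with rfl | hp1
  -- For `p = 1` the linear coefficient vanishes and the expansions do not yield equivalence;
  -- instead both sides are exactly zero for `0 < c < 1`.
  · have h : (fun c : ℝ => gapSum 1 c) =ᶠ[𝓝[>] 0]
        fun c : ℝ => gapLowerBound 1 (perturbedSeq 1 c) := by
      filter_upwards [eventually_small] with c hc
      rw [gapLowerBound_perturbedSeq le_rfl hc.1, gapSum_eq hc.1 hc.2 0]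
      simp
    exact IsEquivalent.refl.congr_left h.symm
  · have hp' : (1 : ℝ) < p := by exact_mod_cast hp1
    have hκ : 4 * ((p : ℝ) - 1) / p ≠ 0 :=
      (div_pos (by linarith) (by linarith)).ne'
    have hlin : ∀ {f : ℝ → ℝ}, (fun c => f c - 4 * ((p : ℝ) - 1) / p * c) =o[𝓝[>] 0]
        (fun c => c) → f ~[𝓝[>] 0] fun c => 4 * ((p : ℝ) - 1) / p * c :=
      fun h => h.trans_isBigO (isBigO_self_const_mul hκ _ _)
    exact (hlin (gapSum_isLittleO hp)).trans (hlin (gapLowerBound_isLittleO hp)).symm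

theorem isLeast_period_perturbedSeq (hp : 1 ≤ p) {c : ℝ} (hc : 0 < c) :
    IsLeast {q : ℕ | 0 < q ∧ Function.Periodic (perturbedSeq p c) (q : ℤ)} p := by
  refine ⟨⟨hp, fun n => ?_⟩, fun q hq => ?_⟩
  · simp [perturbedSeq]
  · have h := hq.2 0
    by_contra! hlt
    rw [zero_add, perturbedSeq, perturbedSeq, if_pos (dvd_zero _), if_neg] at h
    · linarith
    · intro hd
      exact absurd (Nat.le_of_dvd hq.1 (Int.natCast_dvd_natCast.1 hd)) (by omega)

end Asymptotics

theorem theorem1p1 (p : ℕ) (hp : 1 ≤ p) :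
    ((fun c : ℝ => gapSum p c - 4 * ((p : ℝ) - 1) / (p : ℝ) * c) =o[𝓝[>] 0] fun c : ℝ => c) ∧
    ((fun c : ℝ => gapLowerBound p (perturbedSeq p c) - 4 * ((p : ℝ) - 1) / (p : ℝ) * c)
      =o[𝓝[>] 0] fun c : ℝ => c) ∧
    ((fun c : ℝ => gapSum p c) ~[𝓝[>] 0] fun c : ℝ => gapLowerBound p (perturbedSeq p c)) ∧
    (∀ c : ℝ, 0 < c →
      IsLeast {q : ℕ | 0 < q ∧ Function.Periodic (perturbedSeq p c) (q : ℤ)} p) := by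
  exact ⟨gapSum_isLittleO hp, gapLowerBound_isLittleO hp, gapSum_isEquivalent_gapLowerBound hp,
    fun _ hc => isLeast_period_perturbedSeq hp hc⟩
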